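/- Let $(X_t)_{t\ge 0}$ be an irreducible Markov chain on a finite state space with transition matrix $P$ and stationary distribution $\pi$. Call the chain reversible if $\pi(x)P(x,y)=\pi(y)P(y,x)$ for all states $x,y$. Write $\|\mu-\nu\|=\frac12\sum_x|\mu(x)-\nu(x)|$ for the total variation distance, and let $P_L=\frac{P+I}{2}$ be the transition matrix of the lazy version of the chain. Define $$t_{\mathrm L}=\min\Big\{t\ge 0:\ \max_x\big\|P_L^t(x,\cdot)-\pi\big\|\le \tfrac14\Big\},$$ $$t_{\mathrm{ave}}=\min\Big\{t\ge 0:\ \max_x\Big\|\tfrac{P^t(x,\cdot)+P^{t+1}(x,\cdot)}{2}-\pi\Big\|\le \tfrac14\Big\}.$$ **Theorem.** There exist universal positive constants $c$ and $c'$ such that for every irreducible reversible Markov chain on a finite state space both minima exist and $$c\,t_{\mathrm L}\ \le\ \max\{t_{\mathrm{ave}},1\}\qquad\text{and}\qquad t_{\mathrm{ave}}\ \le\ c'\,t_{\mathrm L}.$$ In particular $c\,t_{\mathrm L}\le t_{\mathrm{ave}}\le c'\,t_{\mathrm L}$ whenever $t_{\mathrm{ave}}\ge 1$. -/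

import Mathlib

namespace MarkovMixing

variable {V : Type*} [Fintype V]

/-- Total variation distance between two probability vectors on a finite set. -/
noncomputable def tvDist (μ ν : V → ℝ) : ℝ :=
  (1 / 2) * ∑ x, |μ x - ν x|

variable [DecidableEq V]

/-- `P` is the transition matrix of an irreducible Markov chain on the finite state space `V`
with stationary distribution `π`. -/
structure IsIrreducibleChain (P : Matrix V V ℝ) (π : V → ℝ) : Prop where
  rowStochastic : P ∈ Matrix.rowStochastic ℝ V
  irreducible : P.IsIrreducible
  isProbability : π ∈ stdSimplex ℝ V
  stationary : Matrix.vecMul π P = π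

/-- Reversibility: the detailed balance equations hold. -/
def IsReversible (P : Matrix V V ℝ) (π : V → ℝ) : Prop :=
  ∀ x y, π x * P x y = π y * P y x

/-- Transition matrix `(P + I) / 2` of the lazy version of the chain. -/
noncomputable def lazy (P : Matrix V V ℝ) : Matrix V V ℝ :=
  (1 / 2 : ℝ) • (P + 1)

/-- `d_L(t)`: maximum over starting states of the distance to `π` of the lazy chain at time `t`. -/
noncomputable def lazyDist (P : Matrix V V ℝ) (π : V → ℝ) (t : ℕ) : ℝ :=
  ⨆ x, tvDist (fun y => (lazy P ^ t) x y) π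

/-- Maximum over starting states of the distance to `π` of the average of `P ^ t` and
`P ^ (t + 1)`. -/
noncomputable def aveDist (P : Matrix V V ℝ) (π : V → ℝ) (t : ℕ) : ℝ :=
  ⨆ x, tvDist (fun y => ((P ^ t) x y + (P ^ (t + 1)) x y) / 2) π

/-- Mixing time `t_L(ε)` of the lazy chain (meaningful when some `t` qualifies). -/
noncomputable def tL (P : Matrix V V ℝ) (π : V → ℝ) (ε : ℝ) : ℕ :=
  sInf {t : ℕ | lazyDist P π t ≤ ε}

/-- Average mixing time `t_ave(ε)` (meaningful when some `t` qualifies). -/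
noncomputable def tAve (P : Matrix V V ℝ) (π : V → ℝ) (ε : ℝ) : ℕ :=
  sInf {t : ℕ | aveDist P π t ≤ ε}

end MarkovMixing

namespace MarkovMixing

open Matrix

attribute [local instance] Matrix.linftyOpNormedRing Matrix.linftyOpNormedAlgebra

/-! ### Maximum row-sum norm and stationary stochastic matrices -/

section

variable {V : Type*}

/-! Let `Π` have all rows `π` and `L = lazy P`. In the maximum row-sum norm, the two mixing
conditions say that `L ^ t - Π`, respectively `P ^ t * L - Π`, has norm at most `1/2`.

Average mixing gives lazy mixing without reversibility: `L ^ n` is `P` run for a binomial number of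
steps, and `‖P ^ j * L - Π‖` is nonincreasing in `j`. A Chernoff bound (`norm_lazy_pow_mul_le`)
makes the binomial exceed `t` once `n` is a multiple of `t` plus a constant.

For the converse, fix `|f| ≤ 1`, put `h_j = (P ^ j * L - Π) f`, and take `s` with `‖L ^ s - Π‖ ≤
1/8`. If `G` dominates every `|h_j|` for `8s ≤ j ≤ 9s`, then `|h_{9s}| ≤ L ^ s G`
(`abs_mulVec_le_lazy_pow_mulVec`), which is close to the `π`-mean of `G`. That mean is small by the
spectral theorem: the start `h_{8s}` is small in `L¹(π)`, and each increment is `O(1/s)` there,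
because the factor `(1 + μ)/2` of `L` damps the eigenvalues near `-1`. So the total variation of
`h_j` over the window is bounded by a small constant. -/

/-- The matrix all of whose rows equal `π`. -/
def stationaryMatrix (π : V → ℝ) : Matrix V V ℝ := vecMulVec 1 π

theorem stationaryMatrix_apply (π : V → ℝ) (x y : V) : stationaryMatrix π x y = π y := by
  simp [stationaryMatrix, vecMulVec_apply]

theorem stationaryMatrix_mulVec [Fintype V] (π f : V → ℝ) (x : V) :
    (stationaryMatrix π *ᵥ f) x = ∑ y, π y * f y := by
  simp [mulVec, dotProduct, stationaryMatrix_apply]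

variable [Fintype V] [DecidableEq V]

theorem linfty_opNorm_le_iff [Nonempty V] (A : Matrix V V ℝ) (r : ℝ) :
    ‖A‖ ≤ r ↔ ∀ x, ∑ y, |A x y| ≤ r := by
  rcases lt_or_ge r 0 with hr | hr
  · refine ⟨fun h => absurd ((norm_nonneg _).trans h) (not_le.2 hr), fun h => ?_⟩
    exact absurd ((Finset.sum_nonneg fun y _ => abs_nonneg (A (Classical.arbitrary V) y)).trans
      (h _)) (not_le.2 hr)
  · lift r to NNReal using hr
    rw [linfty_opNorm_def, NNReal.coe_le_coe, Finset.sup_le_iff]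
    simp only [Finset.mem_univ, true_implies, ← NNReal.coe_le_coe, NNReal.coe_sum, coe_nnnorm,
      Real.norm_eq_abs]

theorem iSup_tvDist_le_iff [Nonempty V] (A : Matrix V V ℝ) (π : V → ℝ) (r : ℝ) :
    (⨆ x, tvDist (A x) π) ≤ r ↔ ‖A - stationaryMatrix π‖ ≤ 2 * r := by
  rw [linfty_opNorm_le_iff, ciSup_le_iff (Set.finite_range _).bddAbove]
  refine forall_congr' fun x => ?_
  simp only [tvDist, Matrix.sub_apply, stationaryMatrix_apply]
  constructor <;> intro h <;> linarith

theorem norm_le_one_of_mem_rowStochastic [Nonempty V] {A : Matrix V V ℝ}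
    (hA : A ∈ rowStochastic ℝ V) : ‖A‖ ≤ 1 := by
  rw [linfty_opNorm_le_iff]
  intro x
  rw [← sum_row_of_mem_rowStochastic hA x]
  exact (Finset.sum_congr rfl fun y _ => abs_of_nonneg (nonneg_of_mem_rowStochastic hA)).le

theorem norm_mulVec_apply_le (A : Matrix V V ℝ) (f : V → ℝ) (x : V) :
    |(A *ᵥ f) x| ≤ ‖A‖ * ‖f‖ :=
  (norm_le_pi_norm (A *ᵥ f) x).trans (linfty_opNorm_mulVec A f)

theorem linfty_opNorm_le_of_mulVec [Nonempty V] {A : Matrix V V ℝ} {r : ℝ}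
    (h : ∀ f : V → ℝ, (∀ y, |f y| ≤ 1) → ∀ x, |(A *ᵥ f) x| ≤ r) : ‖A‖ ≤ r := by
  rw [linfty_opNorm_le_iff]
  intro x
  -- The sign vector of row `x` attains that row's absolute sum.
  refine le_trans (le_of_eq ?_) ((le_abs_self _).trans
    (h (fun y => SignType.sign (A x y)) (fun y => ?_) x))
  · simp [mulVec, dotProduct, self_mul_sign]
  · rcases lt_trichotomy (A x y) 0 with h | h | h <;> simp [h]

theorem mulVec_mono {A : Matrix V V ℝ} (hA : A ∈ rowStochastic ℝ V) {f g : V → ℝ}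
    (h : ∀ x, f x ≤ g x) (x : V) : (A *ᵥ f) x ≤ (A *ᵥ g) x :=
  Finset.sum_le_sum fun y _ => mul_le_mul_of_nonneg_left (h y) (nonneg_of_mem_rowStochastic hA)

theorem abs_mulVec_le {A : Matrix V V ℝ} (hA : A ∈ rowStochastic ℝ V) (f : V → ℝ) (x : V) :
    |(A *ᵥ f) x| ≤ (A *ᵥ fun y => |f y|) x := by
  refine (Finset.abs_sum_le_sum_abs _ _).trans (le_of_eq (Finset.sum_congr rfl fun y _ => ?_))
  rw [abs_mul, abs_of_nonneg (nonneg_of_mem_rowStochastic hA)]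

theorem lazy_mem_rowStochastic {P : Matrix V V ℝ} (hP : P ∈ rowStochastic ℝ V) :
    lazy P ∈ rowStochastic ℝ V := by
  have := convex_rowStochastic (R := ℝ) (n := V) hP (one_mem _)
    (by norm_num : (0 : ℝ) ≤ 1 / 2) (by norm_num : (0 : ℝ) ≤ 1 / 2) (by norm_num)
  rwa [← smul_add] at this

theorem commute_lazy (P : Matrix V V ℝ) : Commute P (lazy P) :=
  ((Commute.refl P).add_right (Commute.one_right P)).smul_right _

/-- `π` is a stationary probability vector of the transition matrix `A`. -/
structure IsStationary (A : Matrix V V ℝ) (π : V → ℝ) : Prop where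
  mem : A ∈ rowStochastic ℝ V
  prob : π ∈ stdSimplex ℝ V
  vecMul_eq : vecMul π A = π

namespace IsStationary

variable {A B : Matrix V V ℝ} {π : V → ℝ}

theorem nonempty (h : IsStationary A π) : Nonempty V := by
  by_contra hV
  rw [not_nonempty_iff] at hV
  simpa using h.prob.2

theorem mul_stationaryMatrix (h : IsStationary A π) :
    A * stationaryMatrix π = stationaryMatrix π := by
  rw [stationaryMatrix, mul_vecMulVec, one_vecMul_of_mem_rowStochastic h.mem]

theorem stationaryMatrix_mul (h : IsStationary A π) :
    stationaryMatrix π * A = stationaryMatrix π := by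
  rw [stationaryMatrix, vecMulVec_mul, h.vecMul_eq]

theorem one (hπ : π ∈ stdSimplex ℝ V) : IsStationary (1 : Matrix V V ℝ) π :=
  ⟨one_mem _, hπ, vecMul_one _⟩

theorem mul (hA : IsStationary A π) (hB : IsStationary B π) : IsStationary (A * B) π :=
  ⟨mul_mem hA.mem hB.mem, hA.prob, by rw [← vecMul_vecMul, hA.vecMul_eq, hB.vecMul_eq]⟩

theorem pow (h : IsStationary A π) (n : ℕ) : IsStationary (A ^ n) π := by
  induction n with
  | zero => simpa using one h.prob
  | succ n ih => rw [pow_succ]; exact ih.mul h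

theorem lazy (h : IsStationary A π) : IsStationary (lazy A) π :=
  ⟨lazy_mem_rowStochastic h.mem, h.prob, by
    rw [MarkovMixing.lazy, vecMul_smul, vecMul_add, h.vecMul_eq, vecMul_one, ← two_smul ℝ π,
      smul_smul]
    norm_num⟩

theorem stationaryMatrix (hπ : π ∈ stdSimplex ℝ V) : IsStationary (stationaryMatrix π) π := by
  refine ⟨?_, hπ, ?_⟩
  · rw [mem_rowStochastic_iff_sum]
    exact ⟨fun i j => by rw [stationaryMatrix_apply]; exact hπ.1 j,
      fun i => by simp only [stationaryMatrix_apply]; exact hπ.2⟩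
  · ext y
    simp only [vecMul, dotProduct, stationaryMatrix_apply, ← Finset.sum_mul, hπ.2, one_mul]

theorem norm_sub_le_two (h : IsStationary A π) : ‖A - MarkovMixing.stationaryMatrix π‖ ≤ 2 := by
  have := h.nonempty
  have h1 := norm_le_one_of_mem_rowStochastic h.mem
  have h2 := norm_le_one_of_mem_rowStochastic (stationaryMatrix h.prob).mem
  linarith [norm_sub_le A (MarkovMixing.stationaryMatrix π)]

theorem mul_sub_mul_sub (hA : IsStationary A π) (hB : IsStationary B π) :
    (A - MarkovMixing.stationaryMatrix π) * (B - MarkovMixing.stationaryMatrix π) =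
      A * B - MarkovMixing.stationaryMatrix π := by
  rw [sub_mul, mul_sub, mul_sub, hA.mul_stationaryMatrix, hB.stationaryMatrix_mul,
    (stationaryMatrix hA.prob).mul_stationaryMatrix]
  abel

theorem sub_pow_succ (h : IsStationary A π) (n : ℕ) :
    (A - MarkovMixing.stationaryMatrix π) ^ (n + 1) =
      A ^ (n + 1) - MarkovMixing.stationaryMatrix π := by
  induction n with
  | zero => simp
  | succ n ih => rw [pow_succ, ih, (h.pow _).mul_sub_mul_sub h, ← pow_succ]

theorem mul_sub (hA : IsStationary A π) (B : Matrix V V ℝ) :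
    A * (B - MarkovMixing.stationaryMatrix π) = A * B - MarkovMixing.stationaryMatrix π := by
  rw [_root_.mul_sub, hA.mul_stationaryMatrix]

/-- Powers of a stochastic matrix converge to the stationary matrix geometrically once the
matrix dominates a multiple of the stationary one. -/
theorem exists_norm_pow_sub_le (h : IsStationary A π) {δ : ℝ} (hδ : 0 < δ)
    (hA : ∀ x y, δ * π y ≤ A x y) {ε : ℝ} (hε : 0 < ε) :
    ∃ n, ‖A ^ n - MarkovMixing.stationaryMatrix π‖ ≤ ε := by
  have := h.nonempty
  set S := MarkovMixing.stationaryMatrix π with hS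
  -- Doeblin minorization: the remainder is nonnegative with row sums `1 - δ`, and it acts as `A`
  -- does on matrices killed by `S`.
  have hR : ‖A - δ • S‖ ≤ 1 - δ := by
    rw [linfty_opNorm_le_iff]
    intro x
    have : ∀ y, |(A - δ • S) x y| = A x y - δ * π y := fun y => by
      rw [Matrix.sub_apply, Matrix.smul_apply, hS, stationaryMatrix_apply, smul_eq_mul, abs_of_nonneg]
      linarith [hA x y]
    simp only [this, Finset.sum_sub_distrib, ← Finset.mul_sum, h.prob.2,
      sum_row_of_mem_rowStochastic h.mem]
    simp
  have hpow : ∀ k : ℕ, ‖A ^ (k + 1) - S‖ ≤ (1 - δ) ^ k * 2 := by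
    intro k
    induction k with
    | zero => simpa using h.norm_sub_le_two
    | succ k ih =>
      have hk : A ^ (k + 1 + 1) - S = (A - δ • S) * (A ^ (k + 1) - S) := by
        rw [sub_mul, h.mul_sub, smul_mul_assoc, (stationaryMatrix h.prob).mul_sub,
          (h.pow _).stationaryMatrix_mul, ← pow_succ', sub_self, smul_zero, sub_zero]
      rw [hk]
      calc _ ≤ _ := norm_mul_le _ _
        _ ≤ (1 - δ) * ((1 - δ) ^ k * 2) :=
          mul_le_mul hR ih (norm_nonneg _) ((norm_nonneg _).trans hR)
        _ = _ := by ring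
  obtain ⟨k, hk⟩ := exists_pow_lt_of_lt_one (half_pos hε) (by linarith : 1 - δ < 1)
  exact ⟨k + 1, (hpow k).trans (by linarith)⟩

end IsStationary

end

/-! ### Convergence of the lazy chain, and lazy mixing from average mixing -/

section

variable {V : Type*} [DecidableEq V] {P : Matrix V V ℝ} {π : V → ℝ}

theorem lazy_apply (P : Matrix V V ℝ) (x y : V) :
    lazy P x y = 1 / 2 * (P x y + (1 : Matrix V V ℝ) x y) := by
  simp [lazy]

variable [Fintype V]

theorem IsIrreducibleChain.isStationary (h : IsIrreducibleChain P π) : IsStationary P π :=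
  ⟨h.rowStochastic, h.isProbability, h.stationary⟩

theorem IsIrreducibleChain.exists_pow_pos (h : IsIrreducibleChain P π) (x y : V) :
    ∃ k, 0 < (P ^ k) x y :=
  let ⟨k, _, hk⟩ := (isIrreducible_iff_exists_pow_pos h.irreducible.nonneg).1 h.irreducible x y
  ⟨k, hk⟩

theorem IsIrreducibleChain.pos (h : IsIrreducibleChain P π) (y : V) : 0 < π y := by
  obtain ⟨x, hx⟩ : ∃ x, 0 < π x := by
    by_contra! hx
    have := Finset.sum_nonpos fun x (_ : x ∈ Finset.univ) => hx x
    linarith [h.isProbability.2]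
  obtain ⟨k, hk⟩ := h.exists_pow_pos x y
  rw [← (h.isStationary.pow k).vecMul_eq]
  refine (mul_pos hx hk).trans_le (Finset.single_le_sum (f := fun z => π z * (P ^ k) z y)
    (fun z _ => mul_nonneg (h.isProbability.1 z) ?_) (Finset.mem_univ x))
  exact nonneg_of_mem_rowStochastic (h.isStationary.pow k).mem

theorem half_pow_mul_pow_le_lazy_pow (hP : P ∈ rowStochastic ℝ V) (k : ℕ) (x y : V) :
    (1 / 2) ^ k * (P ^ k) x y ≤ (lazy P ^ k) x y := by
  induction k generalizing y with
  | zero => simp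
  | succ k ih =>
    rw [pow_succ, pow_succ, pow_succ, Matrix.mul_apply, Matrix.mul_apply, Finset.mul_sum]
    refine Finset.sum_le_sum fun z _ => ?_
    have h1 : 1 / 2 * P z y ≤ lazy P z y := by
      rw [lazy_apply]
      have : 0 ≤ (1 : Matrix V V ℝ) z y := nonneg_of_mem_rowStochastic (one_mem _)
      linarith
    calc _ = ((1 / 2) ^ k * (P ^ k) x z) * (1 / 2 * P z y) := by ring
      _ ≤ _ := mul_le_mul (ih z) h1
        (mul_nonneg (by norm_num) (nonneg_of_mem_rowStochastic hP))
        (nonneg_of_mem_rowStochastic (pow_mem (lazy_mem_rowStochastic hP) k))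

theorem lazy_pow_pos_mono (hP : P ∈ rowStochastic ℝ V) {k n : ℕ} (hkn : k ≤ n) {x y : V}
    (h : 0 < (lazy P ^ k) x y) : 0 < (lazy P ^ n) x y := by
  induction n, hkn using Nat.le_induction with
  | base => exact h
  | succ n _ ih =>
    have hL := lazy_mem_rowStochastic hP
    have hy : 0 < lazy P y y := by
      have : 0 ≤ P y y := nonneg_of_mem_rowStochastic hP
      rw [lazy_apply, Matrix.one_apply_eq]
      linarith
    rw [pow_succ, Matrix.mul_apply]
    exact (mul_pos ih hy).trans_le (Finset.single_le_sum
      (f := fun z => (lazy P ^ n) x z * lazy P z y)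
      (fun z _ => mul_nonneg (nonneg_of_mem_rowStochastic (pow_mem hL n))
        (nonneg_of_mem_rowStochastic hL)) (Finset.mem_univ y))

/-- Laziness makes the diagonal positive, so an entry once positive stays positive. A common power
is therefore entrywise positive, and its least entry serves as the Doeblin constant. -/
theorem IsIrreducibleChain.exists_norm_lazy_pow_sub_le (h : IsIrreducibleChain P π) {ε : ℝ}
    (hε : 0 < ε) : ∃ n, ‖lazy P ^ n - stationaryMatrix π‖ ≤ ε := by
  have hV := h.isStationary.nonempty
  choose k hk using fun z : V × V => h.exists_pow_pos z.1 z.2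
  set N := Finset.univ.sup k
  have hpos : ∀ z : V × V, 0 < (lazy P ^ N) z.1 z.2 := fun z =>
    lazy_pow_pos_mono h.rowStochastic (Finset.le_sup (Finset.mem_univ z))
      ((mul_pos (by positivity) (hk z)).trans_le
        (half_pow_mul_pow_le_lazy_pow h.rowStochastic _ _ _))
  obtain ⟨z₀, hz₀⟩ := Finite.exists_min fun z : V × V => (lazy P ^ N) z.1 z.2
  have hmin : ∀ x y, (lazy P ^ N) z₀.1 z₀.2 * π y ≤ (lazy P ^ N) x y := by
    intro x y
    have h1 : π y ≤ 1 := h.isProbability.2 ▸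
      Finset.single_le_sum (fun z _ => h.isProbability.1 z) (Finset.mem_univ y)
    exact (mul_le_of_le_one_right (hpos z₀).le h1).trans (hz₀ (x, y))
  obtain ⟨n, hn⟩ := (h.isStationary.lazy.pow N).exists_norm_pow_sub_le (hpos z₀) hmin hε
  exact ⟨N * n, by rwa [pow_mul]⟩

theorem lazyDist_le_iff [Nonempty V] (P : Matrix V V ℝ) (π : V → ℝ) (t : ℕ) (r : ℝ) :
    lazyDist P π t ≤ r ↔ ‖lazy P ^ t - stationaryMatrix π‖ ≤ 2 * r :=
  iSup_tvDist_le_iff (lazy P ^ t) π r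

theorem aveDist_le_iff [Nonempty V] (P : Matrix V V ℝ) (π : V → ℝ) (t : ℕ) (r : ℝ) :
    aveDist P π t ≤ r ↔ ‖P ^ t * lazy P - stationaryMatrix π‖ ≤ 2 * r := by
  rw [← iSup_tvDist_le_iff]
  have : ∀ x, (P ^ t * lazy P) x = fun y => ((P ^ t) x y + (P ^ (t + 1)) x y) / 2 := by
    intro x
    ext y
    rw [lazy, mul_smul_comm, mul_add, ← pow_succ, mul_one, Matrix.smul_apply, Matrix.add_apply, smul_eq_mul]
    ring
  simp only [this, aveDist]

theorem lazy_pow_succ_mul (P B : Matrix V V ℝ) (n : ℕ) :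
    lazy P ^ (n + 1) * B = (1 / 2 : ℝ) • (lazy P ^ n * B + lazy P ^ n * (P * B)) := by
  rw [pow_succ, mul_assoc, lazy, smul_mul_assoc, mul_smul_comm, add_mul, one_mul, mul_add,
    add_comm]

theorem norm_pow_mul_lazy_sub_antitone (h : IsStationary P π) :
    Antitone fun j : ℕ => ‖P ^ j * lazy P - stationaryMatrix π‖ := by
  have := h.nonempty
  refine antitone_nat_of_succ_le fun j => ?_
  rw [pow_succ', mul_assoc, ← h.mul_sub]
  refine (norm_mul_le _ _).trans (mul_le_of_le_one_left (norm_nonneg _)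
    (norm_le_one_of_mem_rowStochastic h.mem))

/-- Chernoff bound by induction: the norm is at most `1/2` from time `t` on and at most `2 = 1/2 +
3/2` before, while a binomial `X` with parameters `n`, `1/2` has `Pr(X + j < t) ≤ 2 ^ (t - j) * E[2
^ (-X)]` and `E[2 ^ (-X)] = (3/4) ^ n`. -/
theorem norm_lazy_pow_mul_le (h : IsStationary P π) {t : ℕ}
    (ht : ‖P ^ t * lazy P - stationaryMatrix π‖ ≤ 1 / 2) (n j : ℕ) :
    ‖lazy P ^ n * (P ^ j * lazy P) - stationaryMatrix π‖ ≤
      1 / 2 + 3 / 2 * 2 ^ t * (1 / 2) ^ j * (3 / 4) ^ n := by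
  induction n generalizing j with
  | zero =>
    rw [pow_zero, one_mul, pow_zero, mul_one]
    rcases le_or_gt t j with hj | hj
    · exact ((norm_pow_mul_lazy_sub_antitone h hj).trans ht).trans
        (le_add_of_nonneg_right (by positivity))
    · have h1 : (1 : ℝ) ≤ 2 ^ t * (1 / 2) ^ j := by
        rw [one_div, inv_pow, ← div_eq_mul_inv, one_le_div (by positivity)]
        exact pow_le_pow_right₀ (by norm_num) hj.le
      linarith [((h.pow j).mul h.lazy).norm_sub_le_two]
  | succ n ih =>
    have key : lazy P ^ (n + 1) * (P ^ j * lazy P) - stationaryMatrix π =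
        (1 / 2 : ℝ) • ((lazy P ^ n * (P ^ j * lazy P) - stationaryMatrix π) +
          (lazy P ^ n * (P ^ (j + 1) * lazy P) - stationaryMatrix π)) := by
      rw [lazy_pow_succ_mul, ← mul_assoc P, ← pow_succ', smul_add, smul_add, smul_sub, smul_sub]
      have : (stationaryMatrix π : Matrix V V ℝ) =
          (1 / 2 : ℝ) • stationaryMatrix π + (1 / 2 : ℝ) • stationaryMatrix π := by
        rw [← add_smul]; norm_num
      nth_rewrite 1 [this]
      abel
    rw [key, norm_smul, Real.norm_of_nonneg (by norm_num)]
    have h1 := norm_add_le (lazy P ^ n * (P ^ j * lazy P) - stationaryMatrix π)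
      (lazy P ^ n * (P ^ (j + 1) * lazy P) - stationaryMatrix π)
    have h2 := ih j
    have h3 := ih (j + 1)
    rw [pow_succ (1 / 2 : ℝ) j] at h3
    rw [pow_succ (3 / 4 : ℝ) n]
    linarith

theorem norm_lazy_pow_sub_le_of_norm_pow_mul_lazy_sub_le (h : IsStationary P π) {t : ℕ}
    (ht : ‖P ^ t * lazy P - stationaryMatrix π‖ ≤ 1 / 2) :
    ‖lazy P ^ (6 * t + 22) - stationaryMatrix π‖ ≤ 1 / 2 := by
  have h1 : ‖lazy P ^ (3 * t + 11) - stationaryMatrix π‖ ≤ 5 / 8 := by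
    have h2 := norm_lazy_pow_mul_le h ht (3 * t + 10) 0
    rw [pow_zero, one_mul, ← pow_succ] at h2
    refine h2.trans ?_
    -- `2 * (3/4) ^ 3 = 27/32 < 1`; the ten extra steps bring the error `3/2` down to `1/8`.
    have h3 : (2 : ℝ) ^ t * (3 / 4) ^ (3 * t) ≤ 1 := by
      rw [pow_mul, ← mul_pow]
      exact pow_le_one₀ (by norm_num) (by norm_num)
    rw [pow_add]
    have h4 : (3 / 4 : ℝ) ^ 10 ≤ 1 / 12 := by norm_num
    nlinarith [pow_pos (show (0 : ℝ) < 3 / 4 by norm_num) 10]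
  have h2 : 6 * t + 22 = (3 * t + 11) + (3 * t + 11) := by ring
  -- Doubling the time squares the bound: `(5/8) ^ 2 < 1/2`.
  rw [h2, pow_add, ← (h.lazy.pow _).mul_sub_mul_sub (h.lazy.pow _)]
  refine (norm_mul_le _ _).trans ?_
  nlinarith [norm_nonneg (lazy P ^ (3 * t + 11) - stationaryMatrix π)]

end

/-! ### Spectral estimates for reversible chains -/

section

variable {V : Type*} {P : Matrix V V ℝ} {π : V → ℝ}

theorem IsReversible.sub_stationaryMatrix (h : IsReversible P π) :
    IsReversible (P - stationaryMatrix π) π := by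
  intro x y
  rw [Matrix.sub_apply, Matrix.sub_apply, stationaryMatrix_apply, stationaryMatrix_apply]
  linear_combination h x y

variable [Fintype V] [DecidableEq V]

/-- If every eigenvector of a reversible matrix `A` is an eigenvector of `B` with eigenvalue at
most `ε` in absolute value, then `B` contracts the weighted `ℓ²` norm by the factor `ε`. -/
theorem sum_mul_sq_mulVec_le {A B : Matrix V V ℝ} (hπ : ∀ x, 0 < π x)
    (hA : IsReversible A π) {ε : ℝ}
    (hB : ∀ (v : V → ℝ) (μ : ℝ), v ≠ 0 → A *ᵥ v = μ • v → ∃ r : ℝ, |r| ≤ ε ∧ B *ᵥ v = r • v)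
    (f : V → ℝ) : ∑ x, π x * (B *ᵥ f) x ^ 2 ≤ ε ^ 2 * ∑ x, π x * f x ^ 2 := by
  have hs : ∀ x, √(π x) ≠ 0 := fun x => (Real.sqrt_pos.2 (hπ x)).ne'
  have hsq : ∀ x, √(π x) ^ 2 = π x := fun x => Real.sq_sqrt (hπ x).le
  -- Conjugating by `√π` turns detailed balance into symmetry and the weighted `ℓ²` norm into the
  -- Euclidean one.
  let S : Matrix V V ℝ := of fun x y => √(π x) * A x y / √(π y)
  have hS : S.IsHermitian := by
    ext x y
    simp only [S, conjTranspose_apply, of_apply, star_trivial]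
    rw [div_eq_div_iff (hs x) (hs y)]
    have := hA x y
    rw [← hsq x, ← hsq y] at this
    linear_combination -this
  let w : V → V → ℝ := fun i x => hS.eigenvectorBasis i x / √(π x)
  have hw : ∀ i, A *ᵥ w i = hS.eigenvalues i • w i := by
    intro i
    ext x
    have := congrFun (hS.mulVec_eigenvectorBasis i) x
    simp only [mulVec, dotProduct, S, of_apply, Pi.smul_apply, smul_eq_mul, w] at this ⊢
    rw [mul_div_assoc', eq_div_iff (hs x), ← this, Finset.sum_mul]
    refine Finset.sum_congr rfl fun y _ => ?_
    ring
  have hw0 : ∀ i, w i ≠ 0 := by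
    intro i h0
    refine hS.eigenvectorBasis.toBasis.ne_zero i ?_
    ext x
    have := congrFun h0 x
    simpa [w, hs x] using this
  choose r hr hBr using fun i => hB (w i) _ (hw0 i) (hw i)
  let g : EuclideanSpace ℝ V := WithLp.toLp 2 fun x => √(π x) * f x
  let c : V → ℝ := fun i => hS.eigenvectorBasis.repr g i
  have hf : f = ∑ i, c i • w i := by
    ext x
    have := congrArg (fun u : EuclideanSpace ℝ V => u x) (hS.eigenvectorBasis.sum_repr g)
    simp only [WithLp.ofLp_sum, Finset.sum_apply, WithLp.ofLp_smul, Pi.smul_apply, smul_eq_mul,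
      g] at this
    simp only [Finset.sum_apply, Pi.smul_apply, smul_eq_mul, w, mul_div_assoc', ← Finset.sum_div]
    rw [eq_div_iff (hs x)]
    linarith
  have hBf : B *ᵥ f = ∑ i, (c i * r i) • w i := by
    rw [hf, mulVec_sum]
    simp only [mulVec_smul, hBr, smul_smul]
  let g' : EuclideanSpace ℝ V := ∑ i, (c i * r i) • hS.eigenvectorBasis i
  have hg' : ∀ x, g' x = √(π x) * (B *ᵥ f) x := by
    intro x
    rw [hBf]
    simp only [g', WithLp.ofLp_sum, Finset.sum_apply, WithLp.ofLp_smul, Pi.smul_apply,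
      smul_eq_mul, w, Finset.mul_sum]
    refine Finset.sum_congr rfl fun i _ => ?_
    field_simp [hs x]
  have n1 : ∑ x, π x * (B *ᵥ f) x ^ 2 = ∑ i, (c i * r i) ^ 2 := by
    have h1 : ‖g'‖ ^ 2 = ∑ x, π x * (B *ᵥ f) x ^ 2 := by
      rw [EuclideanSpace.real_norm_sq_eq]
      exact Finset.sum_congr rfl fun x _ => by rw [hg', mul_pow, hsq]
    rw [← h1, ← hS.eigenvectorBasis.repr.norm_map, EuclideanSpace.real_norm_sq_eq]
    refine Finset.sum_congr rfl fun i _ => ?_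
    congr 1
    rw [OrthonormalBasis.repr_apply_apply]
    exact hS.eigenvectorBasis.orthonormal.inner_right_fintype _ i
  have n2 : ∑ x, π x * f x ^ 2 = ∑ i, c i ^ 2 := by
    have h1 : ‖g‖ ^ 2 = ∑ x, π x * f x ^ 2 := by
      rw [EuclideanSpace.real_norm_sq_eq]
      exact Finset.sum_congr rfl fun x _ => by simp only [g, mul_pow, hsq]
    rw [← h1, ← hS.eigenvectorBasis.repr.norm_map, EuclideanSpace.real_norm_sq_eq]
  rw [n1, n2, Finset.mul_sum]
  refine Finset.sum_le_sum fun i _ => ?_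
  rw [mul_pow, mul_comm]
  exact mul_le_mul_of_nonneg_right (sq_le_sq' (abs_le.1 (hr i)).1 (abs_le.1 (hr i)).2)
    (sq_nonneg _)

/-- Cauchy-Schwarz form of `sum_mul_sq_mulVec_le` for functions bounded by one. -/
theorem sum_mul_abs_mulVec_le {A B : Matrix V V ℝ} (hπ : ∀ x, 0 < π x) (h1 : ∑ x, π x = 1)
    (hA : IsReversible A π) {ε : ℝ} (hε : 0 ≤ ε)
    (hB : ∀ (v : V → ℝ) (μ : ℝ), v ≠ 0 → A *ᵥ v = μ • v → ∃ r : ℝ, |r| ≤ ε ∧ B *ᵥ v = r • v)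
    {f : V → ℝ} (hf : ∀ x, |f x| ≤ 1) : ∑ x, π x * |(B *ᵥ f) x| ≤ ε := by
  have h2 := sum_mul_sq_mulVec_le hπ hA hB f
  have h3 : ∑ x, π x * f x ^ 2 ≤ 1 := by
    rw [← h1]
    refine Finset.sum_le_sum fun x _ => mul_le_of_le_one_right (hπ x).le ?_
    exact (sq_le_one_iff_abs_le_one _).2 (hf x)
  have h4 : (∑ x, π x * |(B *ᵥ f) x|) ^ 2 ≤ ∑ x, π x * (B *ᵥ f) x ^ 2 := by
    have := Finset.sum_sq_le_sum_mul_sum_of_sq_le_mul Finset.univ (r := fun x => π x * |(B *ᵥ f) x|)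
      (f := π) (g := fun x => π x * (B *ᵥ f) x ^ 2) (fun x _ => (hπ x).le)
      (fun x _ => mul_nonneg (hπ x).le (sq_nonneg _))
      (fun x _ => by rw [mul_pow, sq_abs]; exact le_of_eq (by ring))
    rwa [h1, one_mul] at this
  refine abs_le_of_sq_le_sq' ?_ hε |>.2
  exact h4.trans (h2.trans (mul_le_of_le_one_right (sq_nonneg _) h3))

/-- Each of the `m + 1` terms of the geometric sum is at least `a ^ m`, and the sum times `1 - a` is
at most `1`. -/
theorem pow_mul_one_sub_le {a : ℝ} (h0 : 0 ≤ a) (h1 : a ≤ 1) (m : ℕ) :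
    a ^ m * (1 - a) ≤ 1 / (m + 1) := by
  rw [le_div_iff₀ (by positivity)]
  have h2 : ∑ i ∈ Finset.range (m + 1), a ^ m ≤ ∑ i ∈ Finset.range (m + 1), a ^ i :=
    Finset.sum_le_sum fun i hi =>
      pow_le_pow_of_le_one h0 h1 (Nat.lt_succ_iff.1 (Finset.mem_range.1 hi))
  rw [Finset.sum_const, Finset.card_range, nsmul_eq_mul] at h2
  have h3 := mul_neg_geom_sum a (m + 1)
  have h4 : 0 ≤ a ^ (m + 1) := by positivity
  push_cast at h2
  nlinarith

theorem pow_mulVec_of_mulVec_eq {A : Matrix V V ℝ} {v : V → ℝ} {μ : ℝ} (h : A *ᵥ v = μ • v)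
    (n : ℕ) : (A ^ n) *ᵥ v = μ ^ n • v := by
  induction n with
  | zero => simp
  | succ n ih => rw [pow_succ, ← mulVec_mulVec, h, mulVec_smul, ih, smul_smul, pow_succ']

theorem abs_le_norm_of_mulVec_eq {A : Matrix V V ℝ} {v : V → ℝ} {μ : ℝ} (hv : v ≠ 0)
    (h : A *ᵥ v = μ • v) : |μ| ≤ ‖A‖ := by
  have := linfty_opNorm_mulVec A v
  rw [h, norm_smul] at this
  exact le_of_mul_le_mul_right this (norm_pos_iff.2 hv)

theorem lazy_mulVec_of_mulVec_eq {v : V → ℝ} {μ : ℝ} (h : P *ᵥ v = μ • v) :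
    lazy P *ᵥ v = ((1 + μ) / 2) • v := by
  rw [lazy, smul_mulVec, add_mulVec, h, one_mulVec]
  module

/-- An eigenvector of `P - Π` either has eigenvalue zero or is an eigenvector of `P` that is
annihilated by `Π`. -/
theorem IsStationary.mulVec_eq_of_sub_mulVec_eq (h : IsStationary P π) {v : V → ℝ} {μ : ℝ}
    (hμ : μ ≠ 0) (hv : (P - MarkovMixing.stationaryMatrix π) *ᵥ v = μ • v) :
    P *ᵥ v = μ • v ∧ MarkovMixing.stationaryMatrix π *ᵥ v = 0 := by
  have h1 : MarkovMixing.stationaryMatrix π *ᵥ v = 0 := by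
    have h2 := congrArg (MarkovMixing.stationaryMatrix π *ᵥ ·) hv
    simp only [mulVec_mulVec, mulVec_smul] at h2
    rw [(IsStationary.stationaryMatrix h.prob).mul_sub, h.stationaryMatrix_mul, sub_self,
      zero_mulVec] at h2
    exact (smul_eq_zero.1 h2.symm).resolve_left hμ
  rw [sub_mulVec, h1, sub_zero] at hv
  exact ⟨hv, h1⟩

theorem IsStationary.pow_mul_lazy_sub_mulVec (h : IsStationary P π) {v : V → ℝ} {μ : ℝ}
    (hv : (P - MarkovMixing.stationaryMatrix π) *ᵥ v = μ • v) {m : ℕ} (hm : m ≠ 0) :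
    (P ^ m * MarkovMixing.lazy P - MarkovMixing.stationaryMatrix π) *ᵥ v =
      (μ ^ m * ((1 + μ) / 2)) • v := by
  rcases eq_or_ne μ 0 with rfl | hμ
  · obtain ⟨m, rfl⟩ := Nat.exists_eq_succ_of_ne_zero hm
    rw [zero_smul, sub_mulVec, sub_eq_zero] at hv
    rw [pow_succ, mul_assoc, (commute_lazy P).eq, ← mul_assoc, sub_mulVec, ← mulVec_mulVec, hv,
      mulVec_mulVec, ((h.pow m).mul h.lazy).mul_stationaryMatrix, sub_self]
    simp
  · obtain ⟨h1, h2⟩ := h.mulVec_eq_of_sub_mulVec_eq hμ hv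
    rw [sub_mulVec, h2, sub_zero, ← mulVec_mulVec, lazy_mulVec_of_mulVec_eq h1, mulVec_smul,
      pow_mulVec_of_mulVec_eq h1, smul_smul, mul_comm]

theorem IsStationary.abs_eigenvalue_le_one (h : IsStationary P π) {v : V → ℝ} {μ : ℝ}
    (hv0 : v ≠ 0) (hv : (P - MarkovMixing.stationaryMatrix π) *ᵥ v = μ • v) : |μ| ≤ 1 := by
  rcases eq_or_ne μ 0 with rfl | hμ
  · simp
  · have := h.nonempty
    exact (abs_le_norm_of_mulVec_eq hv0 (h.mulVec_eq_of_sub_mulVec_eq hμ hv).1).trans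
      (norm_le_one_of_mem_rowStochastic h.mem)

theorem IsStationary.eigenvalue_pow_le (h : IsStationary P π) {v : V → ℝ} {μ : ℝ}
    (hv0 : v ≠ 0) (hv : (P - MarkovMixing.stationaryMatrix π) *ᵥ v = μ • v) (hμ : 0 < μ) (s : ℕ) :
    μ ^ s ≤ ‖MarkovMixing.lazy P ^ s - MarkovMixing.stationaryMatrix π‖ := by
  obtain ⟨h1, h2⟩ := h.mulVec_eq_of_sub_mulVec_eq hμ.ne' hv
  have h3 : (MarkovMixing.lazy P ^ s - MarkovMixing.stationaryMatrix π) *ᵥ v =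
      (((1 + μ) / 2) ^ s) • v := by
    rw [sub_mulVec, h2, sub_zero, pow_mulVec_of_mulVec_eq (lazy_mulVec_of_mulVec_eq h1)]
  have h4 := (abs_le.1 (h.abs_eigenvalue_le_one hv0 hv)).2
  calc μ ^ s ≤ ((1 + μ) / 2) ^ s := pow_le_pow_left₀ hμ.le (by linarith) s
    _ ≤ _ := (le_abs_self _).trans (abs_le_norm_of_mulVec_eq hv0 h3)

/-- Positive eigenvalues are controlled by lazy mixing; nonpositive ones, possibly near `-1`, by the
factor `(1 + μ)/2`. -/
theorem IsStationary.abs_pow_mul_le (h : IsStationary P π) {v : V → ℝ} {μ : ℝ}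
    (hv0 : v ≠ 0) (hv : (P - MarkovMixing.stationaryMatrix π) *ᵥ v = μ • v) {s m : ℕ}
    (hs : ‖MarkovMixing.lazy P ^ s - MarkovMixing.stationaryMatrix π‖ ≤ 1 / 8) (hsm : s ≤ m)
    (hm : 3 ≤ m) : |μ ^ m * ((1 + μ) / 2)| ≤ 1 / 8 := by
  have h1 := abs_le.1 (h.abs_eigenvalue_le_one hv0 hv)
  rcases lt_or_ge 0 μ with hμ | hμ
  · have h2 := (h.eigenvalue_pow_le hv0 hv hμ s).trans hs
    have h3 : μ ^ m ≤ 1 / 8 := (pow_le_pow_of_le_one hμ.le h1.2 hsm).trans h2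
    rw [abs_of_nonneg (by positivity)]
    have : 0 ≤ μ ^ m := by positivity
    nlinarith
  · have h2 := pow_mul_one_sub_le (neg_nonneg.2 hμ) (by linarith) m
    have h3 : (1 : ℝ) / (m + 1) ≤ 1 / 4 := by
      have : (3 : ℝ) ≤ m := by exact_mod_cast hm
      exact one_div_le_one_div_of_le (by norm_num) (by linarith)
    rw [abs_mul, abs_pow, abs_of_nonpos hμ, abs_of_nonneg (by linarith : 0 ≤ (1 + μ) / 2)]
    linarith

/-- The increment is `μ ^ i * (μ ^ 2 - 1) / 2`, which vanishes at both ends `μ = ±1` of the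
spectrum. -/
theorem abs_pow_mul_sub_le {μ : ℝ} (h : |μ| ≤ 1) (i : ℕ) :
    |μ ^ (i + 1) * ((1 + μ) / 2) - μ ^ i * ((1 + μ) / 2)| ≤ 1 / (i + 1) := by
  have h1 := pow_mul_one_sub_le (abs_nonneg μ) h i
  have h2 : μ ^ (i + 1) * ((1 + μ) / 2) - μ ^ i * ((1 + μ) / 2) = μ ^ i * -((1 - μ ^ 2) / 2) := by
    ring
  rw [h2, abs_mul, abs_pow, abs_neg, ← sq_abs]
  refine le_trans (mul_le_mul_of_nonneg_left ?_ (by positivity)) h1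
  rw [abs_of_nonneg (by nlinarith [abs_nonneg μ])]
  nlinarith [abs_nonneg μ]

/-! ### Average mixing from lazy mixing -/

/-- If all `|h_j|` in a time window are dominated by `G`, then averaging over the lazy chain
controls the end of the window. -/
theorem abs_mulVec_le_lazy_pow_mulVec (h : IsStationary P π) (f G : V → ℝ) {m s : ℕ}
    (hG : ∀ j, m ≤ j → j ≤ m + s →
      ∀ x, |((P ^ j * lazy P - stationaryMatrix π) *ᵥ f) x| ≤ G x) (u j : ℕ)
    (hj : m + u ≤ j) (hjs : j ≤ m + s) (x : V) :
    |((P ^ j * lazy P - stationaryMatrix π) *ᵥ f) x| ≤ (lazy P ^ u *ᵥ G) x := by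
  induction u generalizing j x with
  | zero => simpa using hG j hj hjs x
  | succ u ih =>
    -- Both `h_i` and `h_{i+1} = P h_i` lie in the window, so `|h_{i+1}|` is bounded by `L ^ u G`
    -- and by `P (L ^ u G)`, hence by their average.
    obtain ⟨i, rfl⟩ : ∃ i, j = i + 1 := ⟨j - 1, by omega⟩
    have h1 := ih (i + 1) (by omega) hjs x
    have h2 : |((P ^ (i + 1) * lazy P - stationaryMatrix π) *ᵥ f) x| ≤
        (P *ᵥ (lazy P ^ u *ᵥ G)) x := by
      rw [pow_succ', mul_assoc, ← h.mul_sub, ← mulVec_mulVec]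
      exact (abs_mulVec_le h.mem _ x).trans
        (mulVec_mono h.mem (fun y => ih i (by omega) (by omega) y) x)
    have h3 : (lazy P ^ (u + 1) *ᵥ G) x =
        1 / 2 * ((P *ᵥ (lazy P ^ u *ᵥ G)) x + (lazy P ^ u *ᵥ G) x) := by
      rw [pow_succ', ← mulVec_mulVec]
      generalize lazy P ^ u *ᵥ G = g
      rw [lazy, smul_mulVec, add_mulVec, one_mulVec, Pi.smul_apply, Pi.add_apply, smul_eq_mul]
    rw [h3]
    linarith

theorem norm_pow_mul_lazy_sub_le_of_norm_lazy_pow_sub_le (h : IsStationary P π)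
    (hπ : ∀ x, 0 < π x) (hr : IsReversible P π) {s : ℕ} (hs3 : 3 ≤ s)
    (hs : ‖lazy P ^ s - stationaryMatrix π‖ ≤ 1 / 8) :
    ‖P ^ (9 * s) * lazy P - stationaryMatrix π‖ ≤ 1 / 2 := by
  have hV := h.nonempty
  refine linfty_opNorm_le_of_mulVec fun f hf x => ?_
  set H : ℕ → V → ℝ := fun j => (P ^ j * lazy P - stationaryMatrix π) *ᵥ f with hH
  set F : V → ℝ := fun y =>
    |H (8 * s) y| + ∑ i ∈ Finset.range s, |H (8 * s + (i + 1)) y - H (8 * s + i) y| with hF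
  have hF0 : ∀ y, 0 ≤ F y := fun y => by positivity
  have hfn : ‖f‖ ≤ 1 := (pi_norm_le_iff_of_nonneg zero_le_one).2 hf
  have hH2 : ∀ j y, |H j y| ≤ 2 := fun j y =>
    (norm_mulVec_apply_le _ f y).trans
      (by nlinarith [((h.pow j).mul h.lazy).norm_sub_le_two,
        norm_nonneg (P ^ j * lazy P - stationaryMatrix π), norm_nonneg f])
  have hHF : ∀ k ≤ s, ∀ y, |H (8 * s + k) y| ≤ F y := by
    intro k hk y
    have h1 : H (8 * s + k) y = H (8 * s) y +
        ∑ i ∈ Finset.range k, (H (8 * s + (i + 1)) y - H (8 * s + i) y) := by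
      rw [Finset.sum_range_sub (fun i => H (8 * s + i) y)]
      simp
    rw [h1]
    refine (abs_add_le _ _).trans (add_le_add le_rfl ((Finset.abs_sum_le_sum_abs _ _).trans ?_))
    exact Finset.sum_le_sum_of_subset_of_nonneg (Finset.range_mono hk)
      fun _ _ _ => abs_nonneg _
  -- `F` has no useful uniform bound; truncating at `2`, which bounds every `|h_j|`, makes the lazy
  -- mixing error at most `2 * (1/8)`.
  set G : V → ℝ := fun y => min (F y) 2
  have hGn : ‖G‖ ≤ 2 := (pi_norm_le_iff_of_nonneg zero_le_two).2 fun y => by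
    rw [Real.norm_of_nonneg (le_min (hF0 y) zero_le_two)]
    exact min_le_right _ _
  have h1 : |H (9 * s) x| ≤ (lazy P ^ s *ᵥ G) x := by
    refine abs_mulVec_le_lazy_pow_mulVec h f G (m := 8 * s) (s := s) (fun j hj hjs y => ?_) s
      (9 * s) (by omega) (by omega) x
    obtain ⟨k, rfl⟩ := Nat.exists_eq_add_of_le hj
    exact le_min (hHF k (by omega) y) (hH2 _ y)
  have h2 : (lazy P ^ s *ᵥ G) x ≤ 1 / 4 + ∑ y, π y * F y := by
    have h3 : (lazy P ^ s *ᵥ G) x =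
        ((lazy P ^ s - stationaryMatrix π) *ᵥ G) x + ∑ y, π y * G y := by
      rw [sub_mulVec, Pi.sub_apply, stationaryMatrix_mulVec]
      ring
    have h4 := (le_abs_self _).trans
      (norm_mulVec_apply_le (lazy P ^ s - stationaryMatrix π) G x)
    have h5 : ∑ y, π y * G y ≤ ∑ y, π y * F y :=
      Finset.sum_le_sum fun y _ => mul_le_mul_of_nonneg_left (min_le_left _ _) (hπ y).le
    rw [h3]
    nlinarith [norm_nonneg (lazy P ^ s - stationaryMatrix π), norm_nonneg G]
  have h3 : ∑ y, π y * |H (8 * s) y| ≤ 1 / 8 :=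
    sum_mul_abs_mulVec_le hπ h.prob.2 hr.sub_stationaryMatrix (by norm_num)
      (fun v μ hv0 hv => ⟨_, h.abs_pow_mul_le hv0 hv hs (by omega) (by omega),
        h.pow_mul_lazy_sub_mulVec hv (by omega)⟩) hf
  have h4 : ∀ i, ∑ y, π y * |H (8 * s + (i + 1)) y - H (8 * s + i) y| ≤ 1 / (8 * s) := by
    intro i
    have h5 : ∀ y, H (8 * s + (i + 1)) y - H (8 * s + i) y =
        (((P ^ (8 * s + i + 1) * lazy P - stationaryMatrix π) -
          (P ^ (8 * s + i) * lazy P - stationaryMatrix π)) *ᵥ f) y := fun y => by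
      rw [sub_mulVec]; rfl
    simp only [h5]
    refine sum_mul_abs_mulVec_le hπ h.prob.2 hr.sub_stationaryMatrix (by positivity)
      (fun v μ hv0 hv =>
      ⟨μ ^ (8 * s + i + 1) * ((1 + μ) / 2) - μ ^ (8 * s + i) * ((1 + μ) / 2), ?_, ?_⟩) hf
    · refine (abs_pow_mul_sub_le (h.abs_eigenvalue_le_one hv0 hv) _).trans ?_
      have : (0 : ℝ) < s := by exact_mod_cast (by omega : 0 < s)
      refine one_div_le_one_div_of_le (by positivity) ?_
      push_cast
      linarith [(Nat.cast_nonneg i : (0 : ℝ) ≤ i)]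
    · rw [sub_mulVec, h.pow_mul_lazy_sub_mulVec hv (by omega),
        h.pow_mul_lazy_sub_mulVec hv (by omega), sub_smul]
  have h5 : ∑ y, π y * F y ≤ 1 / 4 := by
    simp only [hF, mul_add, Finset.sum_add_distrib, Finset.mul_sum]
    rw [Finset.sum_comm]
    have h6 := Finset.sum_le_sum fun i (_ : i ∈ Finset.range s) => h4 i
    rw [Finset.sum_const, Finset.card_range, nsmul_eq_mul] at h6
    have h7 : (s : ℝ) * (1 / (8 * s)) = 1 / 8 := by
      have : (s : ℝ) ≠ 0 := by exact_mod_cast (by omega : s ≠ 0)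
      field_simp
    linarith
  linarith

theorem norm_lazy_pow_three_mul_sub_le (h : IsStationary P π) {t : ℕ}
    (ht : ‖lazy P ^ t - stationaryMatrix π‖ ≤ 1 / 2) :
    ‖lazy P ^ (3 * t) - stationaryMatrix π‖ ≤ 1 / 8 := by
  rw [mul_comm, pow_mul, ← (h.lazy.pow t).sub_pow_succ 2]
  refine (norm_pow_le' _ (by norm_num)).trans ((pow_le_pow_left₀ (norm_nonneg _) ht 3).trans ?_)
  norm_num

/-- A chain that is mixed at time zero has a single state. -/
theorem subsingleton_of_norm_one_sub_le (hπ : π ∈ stdSimplex ℝ V)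
    (h : ‖(1 : Matrix V V ℝ) - stationaryMatrix π‖ ≤ 1 / 2) : Subsingleton V := by
  have hV := (IsStationary.one hπ).nonempty
  rw [linfty_opNorm_le_iff] at h
  -- Row `x` of `1 - Π` has absolute sum `2 * (1 - π x)`; two states of mass `3/4` cannot coexist.
  have h1 : ∀ x, 3 / 4 ≤ π x := by
    intro x
    have h2 := h x
    rw [← Finset.add_sum_erase _ _ (Finset.mem_univ x)] at h2
    have h3 : ∑ y ∈ Finset.univ.erase x, |((1 : Matrix V V ℝ) - stationaryMatrix π) x y| =
        ∑ y ∈ Finset.univ.erase x, π y := by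
      refine Finset.sum_congr rfl fun y hy => ?_
      rw [Matrix.sub_apply, Matrix.one_apply_ne (Finset.ne_of_mem_erase hy).symm, stationaryMatrix_apply,
        zero_sub, abs_neg, abs_of_nonneg (hπ.1 y)]
    have h4 := Finset.add_sum_erase Finset.univ π (Finset.mem_univ x)
    rw [hπ.2] at h4
    rw [h3, Matrix.sub_apply, Matrix.one_apply_eq, stationaryMatrix_apply] at h2
    linarith [le_abs_self (1 - π x)]
  refine ⟨fun x y => by_contra fun hxy => ?_⟩
  have h2 := Finset.sum_le_univ_sum_of_nonneg (s := {x, y}) hπ.1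
  rw [Finset.sum_pair hxy, hπ.2] at h2
  linarith [h1 x, h1 y]

theorem norm_pow_mul_lazy_sub_eq_zero_of_subsingleton [Subsingleton V] (h : IsStationary P π) (t : ℕ) :
    ‖P ^ t * lazy P - stationaryMatrix π‖ = 0 := by
  have hV := h.nonempty
  rw [norm_eq_zero, sub_eq_zero]
  ext x y
  have h1 := sum_row_of_mem_rowStochastic ((h.pow t).mul h.lazy).mem x
  have h2 := sum_row_of_mem_rowStochastic (IsStationary.stationaryMatrix h.prob).mem x
  have : Unique V := { default := y, uniq := fun a => Subsingleton.elim a y }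
  rw [Fintype.sum_unique] at h1 h2
  rw [Subsingleton.elim y default, h1, h2]

end

end MarkovMixing

theorem mainTheorem2 :
    ∃ c c' : ℝ, 0 < c ∧ 0 < c' ∧
      ∀ (V : Type*) [Fintype V] [DecidableEq V] (P : Matrix V V ℝ) (π : V → ℝ),
        MarkovMixing.IsIrreducibleChain P π → MarkovMixing.IsReversible P π →
          (∃ t : ℕ, MarkovMixing.lazyDist P π t ≤ 1 / 4) ∧
          (∃ t : ℕ, MarkovMixing.aveDist P π t ≤ 1 / 4) ∧
          c * (MarkovMixing.tL P π (1 / 4) : ℝ) ≤ max (MarkovMixing.tAve P π (1 / 4) : ℝ) 1 ∧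
          (MarkovMixing.tAve P π (1 / 4) : ℝ) ≤ c' * (MarkovMixing.tL P π (1 / 4) : ℝ) := by
  -- `28 = 6 + 22` absorbs the additive constant through the maximum with `1`; `27 = 9 * 3` combines
  -- the end `9s` of the window with `s = 3 * tL`.
  refine ⟨1 / 28, 27, by norm_num, by norm_num, fun V _ _ P π h hr => ?_⟩
  have hst := h.isStationary
  have hV := hst.nonempty
  have half : (2 : ℝ) * (1 / 4) = 1 / 2 := by norm_num
  have hL : ∃ t : ℕ, MarkovMixing.lazyDist P π t ≤ 1 / 4 := by
    simp only [MarkovMixing.lazyDist_le_iff, half]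
    exact h.exists_norm_lazy_pow_sub_le (by norm_num)
  have key : MarkovMixing.aveDist P π (27 * MarkovMixing.tL P π (1 / 4)) ≤ 1 / 4 := by
    have h1 : MarkovMixing.lazyDist P π (MarkovMixing.tL P π (1 / 4)) ≤ 1 / 4 := Nat.sInf_mem hL
    rw [MarkovMixing.lazyDist_le_iff, half] at h1
    rw [MarkovMixing.aveDist_le_iff, half]
    -- The window argument needs `s ≥ 3`, that is `tL ≥ 1`.
    rcases Nat.eq_zero_or_pos (MarkovMixing.tL P π (1 / 4)) with h0 | h0
    · rw [h0, pow_zero] at h1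
      have := MarkovMixing.subsingleton_of_norm_one_sub_le h.isProbability h1
      rw [MarkovMixing.norm_pow_mul_lazy_sub_eq_zero_of_subsingleton hst]
      norm_num
    · have h2 := MarkovMixing.norm_pow_mul_lazy_sub_le_of_norm_lazy_pow_sub_le hst h.pos hr
        (by omega) (MarkovMixing.norm_lazy_pow_three_mul_sub_le hst h1)
      rwa [← mul_assoc] at h2
  refine ⟨hL, ⟨_, key⟩, ?_, ?_⟩
  · have h1 : MarkovMixing.aveDist P π (MarkovMixing.tAve P π (1 / 4)) ≤ 1 / 4 :=
      Nat.sInf_mem (s := {t | MarkovMixing.aveDist P π t ≤ 1 / 4}) ⟨_, key⟩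
    rw [MarkovMixing.aveDist_le_iff, half] at h1
    have h2 := MarkovMixing.norm_lazy_pow_sub_le_of_norm_pow_mul_lazy_sub_le hst h1
    rw [← half, ← MarkovMixing.lazyDist_le_iff] at h2
    have h3 : (MarkovMixing.tL P π (1 / 4) : ℝ) ≤ 6 * MarkovMixing.tAve P π (1 / 4) + 22 := by
      exact_mod_cast Nat.sInf_le h2
    linarith [le_max_left (MarkovMixing.tAve P π (1 / 4) : ℝ) 1,
      le_max_right (MarkovMixing.tAve P π (1 / 4) : ℝ) 1]
  · exact_mod_cast Nat.sInf_le key
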